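/- Throughout, increasing and convex are meant in the weak sense. Consider a production system with deterioration levels $\mathscr X=\{0,1,\dots,\xi\}$, $\xi\in\mathbb N$, where $\xi$ is the failure level. Production rates lie in $\mathscr S=[0,\bar s]$ with $0<\bar s<\infty$. The deterioration function $f:\mathscr S\to\mathbb R_+$ and the revenue function $r:\mathscr S\to\mathbb R$ are continuous and increasing, with $f(0)=0$ and $r(0)\le 0$, and the maintenance cost function $c_m:\mathscr X\to\mathbb R_+$ is increasing and convex. Let $\lambda\ge 0$ be the base rate. An admissible policy $u$ for a system that starts at level $x$ with time $t\ge 0$ to planned maintenance is a non-anticipating (predictable with respect to the history of the deterioration process) $\mathscr S$-valued production rate $(s_v)_{0\le v\le t}$, where $v$ is the elapsed time, such that a failed system is turned off, i.e. $s_v=0$ whenever the level is $\xi$. Under $u$ the level starts at $x$ and jumps upwards by one unit with instantaneous rate $\lambda f(s_v)$; let $Z_v$ be the level at elapsed time $v$. Put $$J^u_\lambda(x,t)=\mathbb E_u\Big[\int_0^t r(s_v)\,dv-c_m(Z_t)\Big],\qquad J^*_\lambda(x,t)=\sup_u J^u_\lambda(x,t),$$ and let $\Delta_\lambda(x,t)=J^*_\lambda(x,t)-J^*_\lambda(x+1,t)$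 for $x\in\{0,\dots,\xi-1\}$ be the marginal value of less deterioration. Then, for all $\lambda\ge 0$ and all $x\in\{0,\dots,\xi-1\}$, $\Delta_\lambda(x,t)$ is increasing in the time $t\in[0,\infty)$ to planned maintenance. -/

import Mathlib

open MeasureTheory

/-- A single-unit production system.  Deterioration levels are `0, 1, …, failureLevel`, production
rates are the points of `[0, maxRate]`; only the values of `f` and `r` on `[0, maxRate]` and of
`cost` on `{0, …, failureLevel}` matter. -/
structure ProductionSystem where
  /-- the failure level `ξ` -/
  failureLevel : ℕ
  /-- the maximum production rate -/
  maxRate : ℝ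
  maxRate_pos : 0 < maxRate
  /-- the deterioration function -/
  f : ℝ → ℝ
  /-- the revenue function -/
  r : ℝ → ℝ
  /-- the maintenance cost function `c_m` -/
  cost : ℕ → ℝ
  f_continuous : ContinuousOn f (Set.Icc 0 maxRate)
  f_increasing : MonotoneOn f (Set.Icc 0 maxRate)
  f_zero : f 0 = 0
  r_continuous : ContinuousOn r (Set.Icc 0 maxRate)
  r_increasing : MonotoneOn r (Set.Icc 0 maxRate)
  r_zero_nonpos : r 0 ≤ 0
  cost_nonneg : ∀ x ≤ failureLevel, 0 ≤ cost x
  cost_increasing : MonotoneOn cost (Set.Iic failureLevel)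
  cost_convex : ∀ x, x + 2 ≤ failureLevel →
    cost (x + 1) - cost x ≤ cost (x + 2) - cost (x + 1)

/-- A realization of the deterioration process up to the planned maintenance moment: the number
`n` of deterioration increments and the (elapsed) times at which they happen. -/
abbrev JumpPath : Type := Σ n : ℕ, (Fin n → ℝ)

namespace JumpPath

/-- The number of increments strictly before the elapsed time `v`. -/
noncomputable def countBefore (ω : JumpPath) (v : ℝ) : ℕ :=
  (Finset.univ.filter fun i : Fin ω.1 => ω.2 i < v).card

theorem countBefore_le (ω : JumpPath) (v : ℝ) : ω.countBefore v ≤ ω.1 :=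
  (Finset.card_le_univ _).trans_eq (Fintype.card_fin _)

/-- The times of the increments that happen strictly before the elapsed time `v`, for a path whose
increment times are listed in increasing order. -/
noncomputable def historyBefore (ω : JumpPath) (v : ℝ) : Fin (ω.countBefore v) → ℝ :=
  fun i => ω.2 (Fin.castLE (ω.countBefore_le v) i)

end JumpPath

namespace ProductionSystem

/-- A non-anticipating production policy for a system that starts at deterioration level `x`.
The rate in force at the elapsed time `v` may depend on `v`, on the number `n` of increments strictly
before `v` and on their times `τ 0 < … < τ (n - 1)`, that is, the rate process is predictable
for the history of the deterioration process.  A failed system is turned off. -/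
structure Policy (M : ProductionSystem) (x : ℕ) where
  rate : (n : ℕ) → (Fin n → ℝ) → ℝ → ℝ
  measurable_rate : ∀ n, Measurable fun p : (Fin n → ℝ) × ℝ => rate n p.1 p.2
  rate_mem : ∀ n τ v, rate n τ v ∈ Set.Icc 0 M.maxRate
  rate_failed : ∀ n τ v, M.failureLevel ≤ x + n → rate n τ v = 0

variable {M : ProductionSystem} {x : ℕ}

/-- The production rate that the policy induces at the elapsed time `v` along the path `ω`. -/
noncomputable def Policy.rateAt (u : M.Policy x) (ω : JumpPath) (v : ℝ) : ℝ :=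
  u.rate (ω.countBefore v) (ω.historyBefore v) v

/-- The likelihood, with respect to Lebesgue measure, of the increment times `τ` (and of no other
increments) on `[0, t]`, for the point process whose instantaneous intensity is the base rate `lam`
times `f` of the induced production rate:
`(∏ i, lam * f (s (τ i))) * exp (- ∫₀ᵗ lam * f (s v) dv)`. -/
noncomputable def Policy.likelihood (u : M.Policy x) (lam t : ℝ) (n : ℕ) (τ : Fin n → ℝ) : ℝ :=
  (∏ i, lam * M.f (u.rateAt ⟨n, τ⟩ (τ i))) *
    Real.exp (-∫ v in (0 : ℝ)..t, lam * M.f (u.rateAt ⟨n, τ⟩ v))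

/-- The increasing sequences of `n` increment times in `(0, t]`. -/
def orderedTimes (t : ℝ) (n : ℕ) : Set (Fin n → ℝ) :=
  {τ | StrictMono τ ∧ ∀ i, τ i ∈ Set.Ioc 0 t}

/-- The law, under the policy `u` and the base rate `lam`, of the deterioration process over a
horizon of length `t`. -/
noncomputable def Policy.law (u : M.Policy x) (lam t : ℝ) : Measure JumpPath :=
  Measure.sum fun n : ℕ =>
    ((volume.restrict (orderedTimes t n)).withDensity
      fun τ => ENNReal.ofReal (u.likelihood lam t n τ)).map (Sigma.mk n)

/-- The expected profit `J^u_lam(x, t)`: revenue collected over the remaining time `t` minus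
the maintenance cost at the deterioration level reached at the planned maintenance moment. -/
noncomputable def Policy.expectedProfit (u : M.Policy x) (lam t : ℝ) : ℝ :=
  ∫ ω, ((∫ v in (0 : ℝ)..t, M.r (u.rateAt ω v)) - M.cost (x + ω.1)) ∂(u.law lam t)

/-- The optimal expected profit `J*_lam(x, t)`. -/
noncomputable def optimalProfit (M : ProductionSystem) (lam : ℝ) (x : ℕ) (t : ℝ) : ℝ :=
  ⨆ u : M.Policy x, u.expectedProfit lam t

/-- The marginal value of less deterioration, `J*_lam(x, t) - J*_lam(x + 1, t)`. -/
noncomputable def marginalValue (M : ProductionSystem) (lam : ℝ) (x : ℕ) (t : ℝ) : ℝ :=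
  M.optimalProfit lam x t - M.optimalProfit lam (x + 1) t

end ProductionSystem

/-! Write H(p) for the maximum over s of r(s) - λ f(s) p. It is antitone and Lipschitz in the price
p of an increment, and H ≥ r(0). The candidate value function solves V_y' = H(V_y - V_{y+1}) below
failure, with V_y(0) = -c_m(y) and V_ξ(t) = r(0) t - c_m(ξ). The differences a_y = V_y - V_{y+1}
then satisfy a_y' = H(a_y) - H(a_{y+1}), where H(a_{y+1}) is replaced by r(0) at y = ξ - 1.

Monotonicity goes down the levels. At y = ξ - 1 the derivative is nonnegative because H ≥ r(0). If
a_{y+1} is increasing, convexity of the cost gives a_y(0) ≤ a_{y+1}(0). Wherever a_y exceeded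
a_{y+1} it would decrease while a_{y+1} increases, so a_y ≤ a_{y+1} throughout
(`le_of_hasDerivWithinAt_antitone_sub`). As H is antitone, a_y' ≥ 0. This is
`exists_isValueFunction`.

It remains to identify V with the optimal profit (`optimalProfit_eq`). For every policy, the
expected profit is V plus an expected drift (`expectedProfit_eq_add_drift`). This comes from an
identity between two successive increments, telescoped over their number. The drift is nonpositive
by maximality of H and vanishes for the feedback policy that attains H. -/

namespace ProductionSystem

/-! ### The Hamiltonian and its maximizers -/

/-- The production rates that maximize the net revenue rate when an increment costs `p`. -/
def maximizers (M : ProductionSystem) (lam p : ℝ) : Set ℝ :=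
  {s ∈ Set.Icc 0 M.maxRate |
    IsMaxOn (fun s => M.r s - lam * M.f s * p) (Set.Icc 0 M.maxRate) s}

/-- The smallest production rate that maximizes the net revenue rate. -/
noncomputable def bestRate (M : ProductionSystem) (lam p : ℝ) : ℝ :=
  sInf (M.maximizers lam p)

/-- The maximal net revenue rate when an increment costs `p`. -/
noncomputable def hamiltonian (M : ProductionSystem) (lam p : ℝ) : ℝ :=
  M.r (M.bestRate lam p) - lam * M.f (M.bestRate lam p) * p

variable (M : ProductionSystem) (lam : ℝ)

theorem zero_mem_rates : (0 : ℝ) ∈ Set.Icc 0 M.maxRate := ⟨le_rfl, M.maxRate_pos.le⟩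

theorem maxRate_mem_rates : M.maxRate ∈ Set.Icc 0 M.maxRate := ⟨M.maxRate_pos.le, le_rfl⟩

theorem f_nonneg {s : ℝ} (hs : s ∈ Set.Icc 0 M.maxRate) : 0 ≤ M.f s :=
  M.f_zero.symm.trans_le (M.f_increasing M.zero_mem_rates hs hs.1)

theorem f_le {s : ℝ} (hs : s ∈ Set.Icc 0 M.maxRate) : M.f s ≤ M.f M.maxRate :=
  M.f_increasing hs M.maxRate_mem_rates hs.2

theorem r_le {s : ℝ} (hs : s ∈ Set.Icc 0 M.maxRate) : M.r s ≤ M.r M.maxRate :=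
  M.r_increasing hs M.maxRate_mem_rates hs.2

theorem r_zero_le {s : ℝ} (hs : s ∈ Set.Icc 0 M.maxRate) : M.r 0 ≤ M.r s :=
  M.r_increasing M.zero_mem_rates hs hs.1

theorem isLeast_bestRate (p : ℝ) : IsLeast (M.maximizers lam p) (M.bestRate lam p) := by
  have hc : ContinuousOn (fun s => M.r s - lam * M.f s * p) (Set.Icc 0 M.maxRate) :=
    M.r_continuous.sub ((M.f_continuous.const_mul lam).mul_const p)
  obtain ⟨s₀, hs₀, hmax⟩ := isCompact_Icc.exists_isMaxOn ⟨0, M.zero_mem_rates⟩ hc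
  have hset : M.maximizers lam p = Set.Icc 0 M.maxRate ∩
      (fun s => M.r s - lam * M.f s * p) ⁻¹' Set.Ici (M.r s₀ - lam * M.f s₀ * p) := by
    ext s
    refine ⟨fun h => ⟨h.1, h.2 hs₀⟩, fun h => ⟨h.1, fun y hy => ?_⟩⟩
    have h2 : M.r s₀ - lam * M.f s₀ * p ≤ M.r s - lam * M.f s * p := h.2
    exact le_trans (hmax hy) h2
  have hcl : IsClosed (M.maximizers lam p) := by
    rw [hset]
    exact hc.preimage_isClosed_of_isClosed isClosed_Icc isClosed_Ici
  have hcomp : IsCompact (M.maximizers lam p) :=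
    isCompact_Icc.of_isClosed_subset hcl fun s hs => hs.1
  exact hcomp.isLeast_sInf ⟨s₀, hs₀, hmax⟩

theorem bestRate_mem (p : ℝ) : M.bestRate lam p ∈ Set.Icc 0 M.maxRate :=
  (M.isLeast_bestRate lam p).1.1

theorem le_hamiltonian (p : ℝ) {s : ℝ} (hs : s ∈ Set.Icc 0 M.maxRate) :
    M.r s - lam * M.f s * p ≤ M.hamiltonian lam p :=
  (M.isLeast_bestRate lam p).1.2 hs

theorem r_zero_le_hamiltonian (p : ℝ) : M.r 0 ≤ M.hamiltonian lam p := by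
  simpa [M.f_zero] using M.le_hamiltonian lam p M.zero_mem_rates

variable {lam}

/-- Revealed preference: adding the two optimality inequalities contradicts monotonicity of f. The
feedback policy owes its measurability to this lemma. -/
theorem bestRate_antitone (hlam : 0 ≤ lam) : Antitone (M.bestRate lam) := by
  intro p q hpq
  by_contra! hlt
  have hp := M.bestRate_mem lam p
  have hq := M.bestRate_mem lam q
  have h1 := M.le_hamiltonian lam p hq
  -- Strict, because a rate below the least maximizer at q cannot be a maximizer there.
  have h2 : M.r (M.bestRate lam p) - lam * M.f (M.bestRate lam p) * q < M.hamiltonian lam q := by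
    by_contra! hle
    refine hlt.not_ge ((M.isLeast_bestRate lam q).2 ⟨hp, fun y hy => ?_⟩)
    exact (M.le_hamiltonian lam q hy).trans hle
  have h3 := mul_nonneg (mul_nonneg hlam (sub_nonneg.2 (M.f_increasing hp hq hlt.le)))
    (sub_nonneg.2 hpq)
  simp only [hamiltonian] at h1 h2
  linarith

theorem hamiltonian_antitone (hlam : 0 ≤ lam) : Antitone (M.hamiltonian lam) := by
  intro p q hpq
  refine le_trans ?_ (M.le_hamiltonian lam p (M.bestRate_mem lam q))
  have := mul_le_mul_of_nonneg_left hpq (mul_nonneg hlam (M.f_nonneg (M.bestRate_mem lam q)))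
  simp only [hamiltonian]
  linarith

theorem hamiltonian_sub_le (hlam : 0 ≤ lam) {p q : ℝ} (hpq : p ≤ q) :
    M.hamiltonian lam p - M.hamiltonian lam q ≤ lam * M.f M.maxRate * (q - p) := by
  have h1 := M.le_hamiltonian lam q (M.bestRate_mem lam p)
  have h2 := mul_le_mul_of_nonneg_right
    (mul_le_mul_of_nonneg_left (M.f_le (M.bestRate_mem lam p)) hlam) (sub_nonneg.2 hpq)
  simp only [hamiltonian] at *
  linarith

theorem hamiltonian_lipschitz (hlam : 0 ≤ lam) :
    LipschitzWith (Real.toNNReal (lam * M.f M.maxRate)) (M.hamiltonian lam) := by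
  have hC := mul_nonneg hlam (M.f_nonneg M.maxRate_mem_rates)
  refine LipschitzWith.of_dist_le_mul fun p q => ?_
  rw [Real.coe_toNNReal _ hC, Real.dist_eq, Real.dist_eq]
  rcases le_total p q with h | h
  · rw [abs_of_nonneg (sub_nonneg.2 (M.hamiltonian_antitone hlam h)), abs_sub_comm,
      abs_of_nonneg (sub_nonneg.2 h)]
    exact M.hamiltonian_sub_le hlam h
  · rw [abs_sub_comm, abs_of_nonneg (sub_nonneg.2 (M.hamiltonian_antitone hlam h)),
      abs_of_nonneg (sub_nonneg.2 h)]
    exact M.hamiltonian_sub_le hlam h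

theorem hamiltonian_le (hlam : 0 ≤ lam) {p : ℝ} (hp : 0 ≤ p) :
    M.hamiltonian lam p ≤ M.r M.maxRate := by
  have h := mul_nonneg (mul_nonneg hlam (M.f_nonneg (M.bestRate_mem lam p))) hp
  have := M.r_le (M.bestRate_mem lam p)
  simp only [hamiltonian]
  linarith

end ProductionSystem

/-! ### Scalar differential equations and comparison -/

/-- Global solution of a scalar equation with a bounded Lipschitz right-hand side and a continuous
forcing term. -/
theorem exists_hasDerivWithinAt_lipschitz_sub {T B a₀ : ℝ} {K : NNReal} {φ h : ℝ → ℝ}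
    (hT : 0 ≤ T) (hφ : LipschitzWith K φ) (hB : ∀ p, |φ p| ≤ B)
    (hh : ContinuousOn h (Set.Icc 0 T)) :
    ∃ a : ℝ → ℝ, a 0 = a₀ ∧
      ∀ t ∈ Set.Icc 0 T, HasDerivWithinAt a (φ (a t) - h t) (Set.Icc 0 T) t := by
  obtain ⟨C, hC⟩ := isCompact_Icc.exists_bound_of_continuousOn hh
  have hB0 : 0 ≤ B := (abs_nonneg _).trans (hB 0)
  have hC0 : 0 ≤ C := (norm_nonneg _).trans (hC 0 ⟨le_rfl, hT⟩)
  -- The field is bounded by B + C everywhere, so a ball of radius (B + C) T holds the solution on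
  -- the whole interval.
  have hPL : IsPicardLindelof (fun t p => φ p - h t) (⟨0, le_rfl, hT⟩ : Set.Icc (0 : ℝ) T) a₀
      (Real.toNNReal ((B + C) * T)) 0 (Real.toNNReal (B + C)) K := by
    constructor
    · intro t _
      refine LipschitzOnWith.of_dist_le_mul fun p _ q _ => ?_
      simpa using hφ.dist_le_mul p q
    · intro p _
      exact continuousOn_const.sub hh
    · intro t ht p _
      rw [Real.coe_toNNReal _ (by positivity)]
      exact (norm_sub_le _ _).trans (add_le_add (hB p) (hC t ht))
    · rw [Real.coe_toNNReal _ (by positivity), Real.coe_toNNReal _ (by positivity)]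
      simp [hT]
  exact hPL.exists_eq_forall_mem_Icc_hasDerivWithinAt₀

theorem monotoneOn_Icc_of_hasDerivWithinAt {a a' : ℝ → ℝ} {s t : ℝ}
    (ha : ∀ v ∈ Set.Icc s t, HasDerivWithinAt a (a' v) (Set.Icc s t) v)
    (h : ∀ v ∈ Set.Ioo s t, 0 ≤ a' v) : MonotoneOn a (Set.Icc s t) := by
  refine monotoneOn_of_hasDerivWithinAt_nonneg (f' := a') (convex_Icc s t)
    (fun v hv => (ha v hv).continuousWithinAt) (fun v hv => ?_) (fun v hv => ?_)
  · exact (ha v (interior_subset hv)).mono interior_subset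
  · exact h v (by rwa [interior_Icc] at hv)

/-- Comparison for `a' = φ a - φ g` with antitone `φ`: the solution stays below a monotone `g`. -/
theorem le_of_hasDerivWithinAt_antitone_sub {T : ℝ} {φ a g : ℝ → ℝ} (hφ : Antitone φ)
    (ha : ∀ t ∈ Set.Icc 0 T, HasDerivWithinAt a (φ (a t) - φ (g t)) (Set.Icc 0 T) t)
    (hg : MonotoneOn g (Set.Icc 0 T)) (hgc : ContinuousOn g (Set.Icc 0 T)) (h0 : a 0 ≤ g 0) :
    ∀ t ∈ Set.Icc 0 T, a t ≤ g t := by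
  intro t ht
  by_contra! hlt
  have hsub : Set.Icc 0 t ⊆ Set.Icc 0 T := Set.Icc_subset_Icc_right ht.2
  have hac : ContinuousOn a (Set.Icc 0 T) := fun v hv => (ha v hv).continuousWithinAt
  have hcl : IsClosed {v ∈ Set.Icc 0 t | a v ≤ g v} :=
    isClosed_Icc.isClosed_le (hac.mono hsub) (hgc.mono hsub)
  have hcomp : IsCompact {v ∈ Set.Icc 0 t | a v ≤ g v} :=
    isCompact_Icc.of_isClosed_subset hcl fun v hv => hv.1
  -- s is the last time up to t with a ≤ g. After it a > g, so a decreases while g increases, which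
  -- contradicts a t > g t.
  obtain ⟨s, hs, hsmax⟩ := hcomp.exists_isGreatest ⟨0, ⟨le_rfl, ht.1⟩, h0⟩
  have hsT : Set.Icc s t ⊆ Set.Icc 0 T := Set.Icc_subset_Icc hs.1.1 ht.2
  have hmono : MonotoneOn (fun v => -a v) (Set.Icc s t) := by
    refine monotoneOn_Icc_of_hasDerivWithinAt (a' := fun v => -(φ (a v) - φ (g v)))
      (fun v hv => ((ha v (hsT hv)).mono hsT).neg) fun v hv => ?_
    have : g v ≤ a v := by
      by_contra! hlt'
      exact hv.1.not_ge (hsmax ⟨⟨hs.1.1.trans hv.1.le, hv.2.le⟩, hlt'.le⟩)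
    have := hφ this
    linarith
  have h1 := hmono ⟨le_rfl, hs.1.2⟩ ⟨hs.1.2, le_rfl⟩ hs.1.2
  have h2 := hg (hsub hs.1) ht hs.1.2
  have h3 := hs.2
  simp only at h1
  linarith

/-! ### Solving the dynamic programming equation -/

namespace ProductionSystem

/-- `V` solves the dynamic programming equation on the horizon `[0, T]`. -/
structure IsValueFunction (M : ProductionSystem) (lam T : ℝ) (V : ℕ → ℝ → ℝ) : Prop where
  initial : ∀ y, V y 0 = -M.cost y
  hjb : ∀ y < M.failureLevel, ∀ t ∈ Set.Icc 0 T,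
    HasDerivWithinAt (V y) (M.hamiltonian lam (V y t - V (y + 1) t)) (Set.Icc 0 T) t
  failed : ∀ y, M.failureLevel ≤ y → ∀ t ∈ Set.Icc 0 T, V y t = M.r 0 * t - M.cost y
  continuous : ∀ y, Continuous (V y)

theorem exists_isValueFunction (M : ProductionSystem) {lam T : ℝ} (hlam : 0 ≤ lam) (hT : 0 ≤ T) :
    ∃ V, M.IsValueFunction lam T V ∧
      ∀ y < M.failureLevel, MonotoneOn (fun t => V y t - V (y + 1) t) (Set.Icc 0 T) := by
  -- Truncating the price at 0 makes the right-hand side bounded. The truncation is inactive in the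
  -- end, since the differences start nonnegative and increase.
  set φ : ℝ → ℝ := fun p => M.hamiltonian lam (max p 0) with hφdef
  have hφa : Antitone φ := fun p q hpq =>
    M.hamiltonian_antitone hlam (max_le_max_right 0 hpq)
  have hφl : LipschitzWith (Real.toNNReal (lam * M.f M.maxRate)) φ := by
    simpa [hφdef, Function.comp_def] using
      (M.hamiltonian_lipschitz hlam).comp (LipschitzWith.id.max_const 0)
  have hφ0 : ∀ p, M.r 0 ≤ φ p := fun p => M.r_zero_le_hamiltonian lam _
  have hφb : ∀ p, |φ p| ≤ max |M.r 0| |M.r M.maxRate| := fun p =>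
    abs_le_max_abs_abs (hφ0 p) (M.hamiltonian_le hlam (le_max_right _ _))
  suffices H : ∀ m ≤ M.failureLevel, ∃ V : ℕ → ℝ → ℝ,
      (∀ y, V y 0 = -M.cost y) ∧
      (∀ y, m ≤ y → y < M.failureLevel → (∀ t ∈ Set.Icc 0 T,
        HasDerivWithinAt (V y) (M.hamiltonian lam (V y t - V (y + 1) t)) (Set.Icc 0 T) t) ∧
        MonotoneOn (fun t => V y t - V (y + 1) t) (Set.Icc 0 T)) ∧
      (∀ y, M.failureLevel ≤ y → ∀ t, V y t = M.r 0 * t - M.cost y) by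
    obtain ⟨V, h1, h2, h3⟩ := H 0 (Nat.zero_le _)
    have hVc : ∀ y, ContinuousOn (V y) (Set.Icc 0 T) := fun y => by
      rcases lt_or_ge y M.failureLevel with hy | hy
      · exact fun t ht => ((h2 y (Nat.zero_le _) hy).1 t ht).continuousWithinAt
      · rw [funext (h3 y hy)]
        fun_prop
    -- The solutions are controlled only on [0, T]; extending them constantly beyond the endpoints
    -- makes them continuous on the line.
    have hVe : ∀ y, ∀ t ∈ Set.Icc 0 T,
        Set.IccExtend hT ((Set.Icc 0 T).domRestrict (V y)) t = V y t := fun y t ht =>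
      Set.IccExtend_of_mem hT _ ht
    refine ⟨fun y => Set.IccExtend hT ((Set.Icc 0 T).domRestrict (V y)), ⟨fun y => ?_,
      fun y hy t ht => ?_, fun y hy t ht => ?_, fun y => (hVc y).domRestrict.Icc_extend'⟩,
      fun y hy s hs t ht hst => ?_⟩
    · rw [hVe y 0 ⟨le_rfl, hT⟩, h1]
    · rw [hVe y t ht, hVe (y + 1) t ht]
      exact ((h2 y (Nat.zero_le _) hy).1 t ht).congr (hVe y) (hVe y t ht)
    · rw [hVe y t ht, h3 y hy]
    · simp only [hVe _ s hs, hVe _ t ht]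
      exact (h2 y (Nat.zero_le _) hy).2 hs ht hst
  intro m hm
  induction hm using Nat.decreasingInduction with
  | self =>
    exact ⟨fun y t => M.r 0 * t - M.cost y, fun y => by simp, fun y h1 h2 => by omega,
      fun y _ t => rfl⟩
  | of_succ m hm ih =>
    obtain ⟨V, hV0, hV, hVf⟩ := ih
    have ha0 : 0 ≤ M.cost (m + 1) - M.cost m :=
      sub_nonneg.2 (M.cost_increasing (Set.mem_Iic.2 hm.le) (Set.mem_Iic.2 hm) (Nat.le_succ m))
    -- h is the derivative of V (m + 1): the constant r(0) if m + 1 is the failure level, the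
    -- Hamiltonian of the next difference otherwise.
    obtain ⟨h, hhc, hhd, hmono⟩ : ∃ h : ℝ → ℝ, ContinuousOn h (Set.Icc 0 T) ∧
        (∀ t ∈ Set.Icc 0 T, HasDerivWithinAt (V (m + 1)) (h t) (Set.Icc 0 T) t) ∧
        ∀ a : ℝ → ℝ, a 0 = M.cost (m + 1) - M.cost m →
          (∀ t ∈ Set.Icc 0 T, HasDerivWithinAt a (φ (a t) - h t) (Set.Icc 0 T) t) →
          MonotoneOn a (Set.Icc 0 T) := by
      rcases (Nat.succ_le_of_lt hm).eq_or_lt with heq | hlt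
      · refine ⟨fun _ => M.r 0, continuousOn_const, fun t _ => ?_, fun a _ ha => ?_⟩
        · have : V (m + 1) = fun t => M.r 0 * t - M.cost (m + 1) :=
            funext (hVf _ heq.ge)
          rw [this]
          simpa using (((hasDerivAt_id t).const_mul (M.r 0)).sub_const
            (M.cost (m + 1))).hasDerivWithinAt
        · exact monotoneOn_Icc_of_hasDerivWithinAt ha fun v _ => sub_nonneg.2 (hφ0 _)
      · obtain ⟨hd, hmon⟩ := hV (m + 1) le_rfl hlt
        set g : ℝ → ℝ := fun t => V (m + 1) t - V (m + 1 + 1) t with hg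
        have hg0 : M.cost (m + 1) - M.cost m ≤ g 0 := by
          have := M.cost_convex m hlt
          simp only [hg, hV0]
          linarith
        have hgφ : ∀ t ∈ Set.Icc 0 T, M.hamiltonian lam (g t) = φ (g t) := fun t ht => by
          have : 0 ≤ g t := (ha0.trans hg0).trans (hmon ⟨le_rfl, hT⟩ ht ht.1)
          simp only [hφdef, max_eq_left this]
        have hgc : ContinuousOn g (Set.Icc 0 T) := by
          have h1 : ContinuousOn (V (m + 1)) (Set.Icc 0 T) := fun t ht =>
            (hd t ht).continuousWithinAt
          have h2 : ContinuousOn (V (m + 1 + 1)) (Set.Icc 0 T) := by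
            rcases (Nat.succ_le_of_lt hlt).eq_or_lt with heq' | hlt'
            · rw [funext (hVf (m + 1 + 1) heq'.ge)]
              fun_prop
            · exact fun t ht =>
                ((hV (m + 1 + 1) (Nat.le_succ _) hlt').1 t ht).continuousWithinAt
          exact h1.sub h2
        refine ⟨fun t => φ (g t), hφl.continuous.comp_continuousOn hgc,
          fun t ht => (hd t ht).congr_deriv (hgφ t ht), fun a ha0' ha => ?_⟩
        have hle := le_of_hasDerivWithinAt_antitone_sub hφa ha hmon hgc (ha0'.trans_le hg0)
        exact monotoneOn_Icc_of_hasDerivWithinAt ha fun v hv =>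
          sub_nonneg.2 (hφa (hle v ⟨hv.1.le, hv.2.le⟩))
    obtain ⟨a, ha_zero, had⟩ := exists_hasDerivWithinAt_lipschitz_sub
      (a₀ := M.cost (m + 1) - M.cost m) hT hφl hφb hhc
    have hamono := hmono a ha_zero had
    have hval : ∀ t ∈ Set.Icc 0 T, φ (a t) = M.hamiltonian lam (a t) := fun t ht => by
      have : 0 ≤ a t := (ha0.trans ha_zero.ge).trans (hamono ⟨le_rfl, hT⟩ ht ht.1)
      simp only [hφdef, max_eq_left this]
    refine ⟨Function.update V m (fun t => V (m + 1) t + a t), fun y => ?_, fun y hmy hy => ?_,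
      fun y hy => ?_⟩
    · rcases eq_or_ne y m with rfl | hne
      · simp only [Function.update_self, hV0, ha_zero]
        ring
      · simp [hne, hV0]
    · rcases hmy.eq_or_lt with rfl | hlt
      · have hne : m + 1 ≠ m := by omega
        simp only [Function.update_self, Function.update_of_ne hne, add_sub_cancel_left]
        refine ⟨fun t ht => ?_, hamono⟩
        have := (hhd t ht).add (had t ht)
        rw [hval t ht, add_sub_cancel] at this
        exact this
      · have hne : y ≠ m := by omega
        have hne' : y + 1 ≠ m := by omega
        simp only [Function.update_of_ne hne, Function.update_of_ne hne']
        exact hV y hlt hy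
    · have hne : y ≠ m := by omega
      simp only [Function.update_of_ne hne]
      exact hVf y hy

end ProductionSystem

/-! ### Measurability, ordered increment times and likelihoods -/

theorem intervalIntegrable_of_measurable_of_abs_le {g : ℝ → ℝ} {C : ℝ} (hg : Measurable g)
    (hC : ∀ v, |g v| ≤ C) (a b : ℝ) : IntervalIntegrable g volume a b :=
  (intervalIntegrable_const (c := C)).mono_fun hg.aestronglyMeasurable
    (Filter.Eventually.of_forall fun v => (hC v).trans (le_abs_self C))

theorem measurable_primitive {α : Type*} [MeasurableSpace α] {g : α × ℝ → ℝ} (hg : Measurable g) :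
    Measurable fun p : α × ℝ => ∫ v in (0 : ℝ)..p.2, g (p.1, v) := by
  -- The interval integral is a difference of integrals over (0, p.2] and (p.2, 0]; each becomes an
  -- integral of a jointly measurable indicator.
  have key : ∀ l u : (α × ℝ) × ℝ → ℝ, Measurable l → Measurable u →
      Measurable fun p : α × ℝ => ∫ v, Set.indicator {q | l q < q.2 ∧ q.2 ≤ u q}
        (fun q : (α × ℝ) × ℝ => g (q.1.1, q.2)) (p, v) := by
    intro l u hl hu
    have hm : Measurable (Set.indicator {q | l q < q.2 ∧ q.2 ≤ u q}
        (fun q : (α × ℝ) × ℝ => g (q.1.1, q.2))) :=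
      Measurable.indicator (by fun_prop)
        ((measurableSet_lt hl measurable_snd).inter (measurableSet_le measurable_snd hu))
    exact (hm.stronglyMeasurable.integral_prod_right (f := fun p v => Set.indicator
      {q | l q < q.2 ∧ q.2 ≤ u q} (fun q : (α × ℝ) × ℝ => g (q.1.1, q.2)) (p, v))).measurable
  have h1 := key (fun _ => 0) (fun q => q.1.2) measurable_const (by fun_prop)
  have h2 := key (fun q => q.1.2) (fun _ => 0) (by fun_prop) measurable_const
  convert! h1.sub h2 using 2 with p
  rw [intervalIntegral, ← integral_indicator measurableSet_Ioc,
    ← integral_indicator measurableSet_Ioc]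
  rfl

namespace JumpPath

theorem countBefore_eq_sum {n : ℕ} (τ : Fin n → ℝ) (v : ℝ) :
    countBefore ⟨n, τ⟩ v = ∑ i, if τ i < v then 1 else 0 :=
  Finset.card_filter _ _

/-- Histories are strict, so an increment at w is not yet seen at any v ≤ w, including v = w. This
is predictability in its combinatorial form. -/
theorem countBefore_snoc {n : ℕ} (τ : Fin n → ℝ) {v w : ℝ} (hv : v ≤ w) :
    countBefore ⟨n + 1, Fin.snoc τ w⟩ v = countBefore ⟨n, τ⟩ v := by
  rw [countBefore_eq_sum, countBefore_eq_sum, Fin.sum_univ_castSucc]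
  simp [hv]

theorem countBefore_of_forall_lt {n : ℕ} {τ : Fin n → ℝ} {v : ℝ} (hv : ∀ i, τ i < v) :
    countBefore ⟨n, τ⟩ v = n := by
  simp [countBefore_eq_sum, hv]

theorem measurable_countBefore (n : ℕ) :
    Measurable fun p : (Fin n → ℝ) × ℝ => countBefore ⟨n, p.1⟩ p.2 := by
  simp only [countBefore_eq_sum]
  exact Finset.measurable_sum _ fun i _ => Measurable.ite
    (measurableSet_lt (by fun_prop) (by fun_prop)) measurable_const measurable_const

theorem measurable_of_comp_mk {β : Type*} [MeasurableSpace β] {g : JumpPath → β}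
    (hg : ∀ n, Measurable fun τ : Fin n → ℝ => g ⟨n, τ⟩) : Measurable g := by
  intro s hs
  rw [MeasurableSpace.measurableSet_iInf]
  exact fun n => hg n hs

theorem measurable_mk (n : ℕ) : Measurable fun τ : Fin n → ℝ => (⟨n, τ⟩ : JumpPath) := by
  intro s hs
  rw [MeasurableSpace.measurableSet_iInf] at hs
  exact hs n

end JumpPath

/-- The time of the last increment, or `0` if there is none. -/
def lastTime : {n : ℕ} → (Fin n → ℝ) → ℝ
  | 0, _ => 0
  | n + 1, τ => τ (Fin.last n)

@[simp]
theorem lastTime_snoc {n : ℕ} (τ : Fin n → ℝ) (w : ℝ) :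
    lastTime (Fin.snoc τ w : Fin (n + 1) → ℝ) = w := by
  simp [lastTime]

theorem measurable_lastTime (n : ℕ) : Measurable (lastTime : (Fin n → ℝ) → ℝ) := by
  cases n with
  | zero => exact measurable_const
  | succ n => exact measurable_pi_apply _

namespace ProductionSystem

theorem measurableSet_orderedTimes (t : ℝ) (n : ℕ) : MeasurableSet (orderedTimes t n) := by
  have : orderedTimes t n = (⋂ i, ⋂ j, ⋂ _ : i < j, {τ | τ i < τ j}) ∩
      ⋂ i, (fun τ : Fin n → ℝ => τ i) ⁻¹' Set.Ioc 0 t := by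
    ext τ
    simp [orderedTimes, StrictMono]
  rw [this]
  refine MeasurableSet.inter (MeasurableSet.iInter fun i => MeasurableSet.iInter fun j =>
    MeasurableSet.iInter fun _ => measurableSet_lt (measurable_pi_apply _) (measurable_pi_apply _))
    (MeasurableSet.iInter fun i => measurable_pi_apply i measurableSet_Ioc)

theorem volume_orderedTimes_lt_top (t : ℝ) (n : ℕ) : volume (orderedTimes t n) < ⊤ := by
  have hsub : orderedTimes t n ⊆ Set.univ.pi fun _ => Set.Ioc 0 t := fun τ hτ i _ => hτ.2 i
  refine (measure_mono hsub).trans_lt ?_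
  rw [Real.volume_pi_Ioc]
  exact ENNReal.prod_lt_top fun i _ => ENNReal.ofReal_lt_top

theorem le_lastTime {n : ℕ} {τ : Fin n → ℝ} (hτ : StrictMono τ) (i : Fin n) :
    τ i ≤ lastTime τ := by
  cases n with
  | zero => exact i.elim0
  | succ n => exact hτ.monotone (Fin.le_last i)

theorem lastTime_mem {t : ℝ} (ht : 0 ≤ t) {n : ℕ} {τ : Fin n → ℝ} (hτ : τ ∈ orderedTimes t n) :
    lastTime τ ∈ Set.Icc 0 t := by
  cases n with
  | zero => exact ⟨le_rfl, ht⟩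
  | succ n => exact ⟨(hτ.2 _).1.le, (hτ.2 _).2⟩

theorem snoc_mem_orderedTimes_iff {t : ℝ} {n : ℕ} {τ : Fin n → ℝ} {w : ℝ} :
    (Fin.snoc τ w : Fin (n + 1) → ℝ) ∈ orderedTimes t (n + 1) ↔
      τ ∈ orderedTimes t n ∧ w ∈ Set.Ioc (lastTime τ) t := by
  constructor
  · rintro ⟨hmono, hmem⟩
    have hlast : w ∈ Set.Ioc 0 t := by simpa using hmem (Fin.last n)
    refine ⟨⟨fun i j hij => ?_, fun i => ?_⟩, ?_, hlast.2⟩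
    · simpa using hmono (Fin.castSucc_lt_castSucc_iff.2 hij)
    · simpa using hmem i.castSucc
    · cases n with
      | zero => exact hlast.1
      | succ n => simpa [lastTime] using hmono (Fin.castSucc_lt_last (Fin.last n))
  · rintro ⟨⟨hmono, hmem⟩, hw, hwt⟩
    have hlt : ∀ i, τ i < w := fun i => (le_lastTime hmono i).trans_lt hw
    refine ⟨fun i j hij => ?_, fun i => ?_⟩
    · induction j using Fin.lastCases with
      | last =>
        induction i using Fin.lastCases with
        | last => exact absurd hij (lt_irrefl _)
        | cast i => simpa using hlt i
      | cast j =>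
        induction i using Fin.lastCases with
        | last => exact absurd hij (Fin.castSucc_lt_last j).not_gt
        | cast i => simpa using hmono (Fin.castSucc_lt_castSucc_iff.1 hij)
    · induction i using Fin.lastCases with
      | last =>
        have : 0 ≤ lastTime τ := by
          cases n with
          | zero => exact le_rfl
          | succ n => exact (hmem _).1.le
        simpa using ⟨this.trans_lt hw, hwt⟩
      | cast i => simpa using hmem i

variable {M : ProductionSystem} {x : ℕ}

theorem measurable_comp_rate {α : Type*} [MeasurableSpace α] {g : ℝ → ℝ} {s : α → ℝ}
    (hg : ContinuousOn g (Set.Icc 0 M.maxRate)) (hs : Measurable s)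
    (hmem : ∀ a, s a ∈ Set.Icc 0 M.maxRate) : Measurable fun a => g (s a) := by
  have hext : Continuous (Set.IccExtend M.maxRate_pos.le ((Set.Icc 0 M.maxRate).domRestrict g)) :=
    hg.domRestrict.Icc_extend'
  have : (fun a => g (s a)) =
      fun a => Set.IccExtend M.maxRate_pos.le ((Set.Icc 0 M.maxRate).domRestrict g) (s a) := by
    funext a
    rw [Set.IccExtend_of_mem _ _ (hmem a)]
    rfl
  rw [this]
  exact hext.measurable.comp hs

namespace Policy

variable (u : M.Policy x) {n : ℕ}

theorem rate_congr {m m' : ℕ} {τ : Fin m → ℝ} {τ' : Fin m' → ℝ} (h : m = m')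
    (hτ : ∀ i, τ i = τ' (Fin.cast h i)) (v : ℝ) : u.rate m τ v = u.rate m' τ' v := by
  subst h
  congr 1
  exact funext hτ

theorem rateAt_mem (ω : JumpPath) (v : ℝ) : u.rateAt ω v ∈ Set.Icc 0 M.maxRate :=
  u.rate_mem _ _ _

theorem rateAt_snoc (τ : Fin n → ℝ) {v w : ℝ} (hv : v ≤ w) :
    u.rateAt ⟨n + 1, Fin.snoc τ w⟩ v = u.rateAt ⟨n, τ⟩ v := by
  refine u.rate_congr (JumpPath.countBefore_snoc τ hv) (fun i => ?_) v
  have hi : (i : ℕ) < n := i.2.trans_le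
    ((JumpPath.countBefore_snoc τ hv).trans_le (JumpPath.countBefore_le ⟨n, τ⟩ v))
  have : Fin.castLE (JumpPath.countBefore_le ⟨n + 1, Fin.snoc τ w⟩ v) i =
      Fin.castSucc ⟨i, hi⟩ := rfl
  simp only [JumpPath.historyBefore]
  rw [this, Fin.snoc_castSucc]
  rfl

theorem rateAt_of_forall_lt {τ : Fin n → ℝ} {v : ℝ} (hv : ∀ i, τ i < v) :
    u.rateAt ⟨n, τ⟩ v = u.rate n τ v :=
  u.rate_congr (JumpPath.countBefore_of_forall_lt hv) (fun _ => rfl) v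

/-- The length of the history depends on the path; splitting by its finitely many values leaves
rates of fixed arity, whose measurability is known. -/
theorem rateAt_eq_sum (τ : Fin n → ℝ) (v : ℝ) :
    u.rateAt ⟨n, τ⟩ v = ∑ m : Fin (n + 1), if JumpPath.countBefore ⟨n, τ⟩ v = m then
      u.rate m (fun i => τ (Fin.castLE (Nat.lt_succ_iff.1 m.2) i)) v else 0 := by
  rw [Finset.sum_eq_single
    ⟨JumpPath.countBefore ⟨n, τ⟩ v, Nat.lt_succ_iff.2 (JumpPath.countBefore_le ⟨n, τ⟩ v)⟩]
  · rw [if_pos rfl]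
    rfl
  · intro m _ hm
    rw [if_neg]
    exact fun h => hm (Fin.ext h.symm)
  · simp

theorem measurable_rateAt (n : ℕ) :
    Measurable fun p : (Fin n → ℝ) × ℝ => u.rateAt ⟨n, p.1⟩ p.2 := by
  simp only [rateAt_eq_sum]
  refine Finset.measurable_sum _ fun m _ => Measurable.ite
    (JumpPath.measurable_countBefore n (measurableSet_singleton _)) ?_ measurable_const
  have hr : Measurable fun p : (Fin n → ℝ) × ℝ =>
      ((fun i : Fin m => p.1 (Fin.castLE (Nat.lt_succ_iff.1 m.2) i)), p.2) := by fun_prop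
  exact (u.measurable_rate m).comp hr

theorem measurable_f_rateAt (n : ℕ) :
    Measurable fun p : (Fin n → ℝ) × ℝ => M.f (u.rateAt ⟨n, p.1⟩ p.2) :=
  measurable_comp_rate M.f_continuous (u.measurable_rateAt n) fun _ => u.rateAt_mem _ _

theorem measurable_r_rateAt (n : ℕ) :
    Measurable fun p : (Fin n → ℝ) × ℝ => M.r (u.rateAt ⟨n, p.1⟩ p.2) :=
  measurable_comp_rate M.r_continuous (u.measurable_rateAt n) fun _ => u.rateAt_mem _ _

theorem measurable_likelihood (lam : ℝ) (n : ℕ) :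
    Measurable fun p : (Fin n → ℝ) × ℝ => u.likelihood lam p.2 n p.1 := by
  refine Measurable.mul (Finset.measurable_prod _ fun i _ => ?_) ?_
  · have hi : Measurable fun p : (Fin n → ℝ) × ℝ => (p.1, p.1 i) := by fun_prop
    exact ((u.measurable_f_rateAt n).comp hi).const_mul lam
  · exact Real.measurable_exp.comp
      (measurable_primitive ((u.measurable_f_rateAt n).const_mul lam)).neg

/-- The revenue collected up to the elapsed time `w`. -/
noncomputable def revenue (n : ℕ) (τ : Fin n → ℝ) (w : ℝ) : ℝ :=
  ∫ v in (0 : ℝ)..w, M.r (u.rateAt ⟨n, τ⟩ v)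

theorem measurable_revenue (n : ℕ) :
    Measurable fun p : (Fin n → ℝ) × ℝ => u.revenue n p.1 p.2 :=
  measurable_primitive (u.measurable_r_rateAt n)

theorem abs_r_rateAt_le (ω : JumpPath) (v : ℝ) :
    |M.r (u.rateAt ω v)| ≤ max |M.r 0| |M.r M.maxRate| :=
  abs_le_max_abs_abs (M.r_zero_le (u.rateAt_mem ω v)) (M.r_le (u.rateAt_mem ω v))

theorem abs_revenue_le (τ : Fin n → ℝ) (w : ℝ) :
    |u.revenue n τ w| ≤ max |M.r 0| |M.r M.maxRate| * |w| := by
  have := intervalIntegral.norm_integral_le_of_norm_le_const (a := 0) (b := w)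
    (f := fun v => M.r (u.rateAt ⟨n, τ⟩ v)) fun v _ => u.abs_r_rateAt_le ⟨n, τ⟩ v
  simpa [revenue] using this

theorem revenue_snoc (τ : Fin n → ℝ) {w : ℝ} (hw : 0 ≤ w) :
    u.revenue (n + 1) (Fin.snoc τ w) w = u.revenue n τ w := by
  refine intervalIntegral.integral_congr fun v hv => ?_
  rw [Set.uIcc_of_le hw] at hv
  rw [u.rateAt_snoc τ hv.2]

variable {lam : ℝ}

theorem hazard_nonneg (hlam : 0 ≤ lam) (ω : JumpPath) (v : ℝ) :
    0 ≤ lam * M.f (u.rateAt ω v) :=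
  mul_nonneg hlam (M.f_nonneg (u.rateAt_mem ω v))

theorem hazard_le (hlam : 0 ≤ lam) (ω : JumpPath) (v : ℝ) :
    lam * M.f (u.rateAt ω v) ≤ lam * M.f M.maxRate :=
  mul_le_mul_of_nonneg_left (M.f_le (u.rateAt_mem ω v)) hlam

theorem likelihood_nonneg (hlam : 0 ≤ lam) (t : ℝ) (τ : Fin n → ℝ) :
    0 ≤ u.likelihood lam t n τ :=
  mul_nonneg (Finset.prod_nonneg fun _ _ => u.hazard_nonneg hlam _ _) (Real.exp_nonneg _)

theorem likelihood_le (hlam : 0 ≤ lam) {t : ℝ} (ht : 0 ≤ t) (τ : Fin n → ℝ) :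
    u.likelihood lam t n τ ≤ (lam * M.f M.maxRate) ^ n := by
  have h1 : ∏ i, lam * M.f (u.rateAt ⟨n, τ⟩ (τ i)) ≤ (lam * M.f M.maxRate) ^ n := by
    simpa using Finset.prod_le_prod (s := Finset.univ)
      (fun i _ => u.hazard_nonneg hlam ⟨n, τ⟩ (τ i)) (fun i _ => u.hazard_le hlam ⟨n, τ⟩ (τ i))
  have h2 : Real.exp (-∫ v in (0 : ℝ)..t, lam * M.f (u.rateAt ⟨n, τ⟩ v)) ≤ 1 := by
    rw [Real.exp_le_one_iff, neg_nonpos]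
    exact intervalIntegral.integral_nonneg ht fun v _ => u.hazard_nonneg hlam _ _
  have h3 : 0 ≤ (lam * M.f M.maxRate) ^ n :=
    pow_nonneg (mul_nonneg hlam (M.f_nonneg M.maxRate_mem_rates)) n
  exact (mul_le_mul h1 h2 (Real.exp_nonneg _) h3).trans_eq (mul_one _)

theorem likelihood_snoc (lam : ℝ) {τ : Fin n → ℝ} {w : ℝ} (hw : 0 ≤ w) (hτ : ∀ i, τ i < w) :
    u.likelihood lam w (n + 1) (Fin.snoc τ w) =
      u.likelihood lam w n τ * (lam * M.f (u.rateAt ⟨n, τ⟩ w)) := by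
  have hint : ∫ v in (0 : ℝ)..w, lam * M.f (u.rateAt ⟨n + 1, Fin.snoc τ w⟩ v) =
      ∫ v in (0 : ℝ)..w, lam * M.f (u.rateAt ⟨n, τ⟩ v) := by
    refine intervalIntegral.integral_congr fun v hv => ?_
    rw [Set.uIcc_of_le hw] at hv
    rw [u.rateAt_snoc τ hv.2]
  simp only [likelihood]
  rw [hint, Fin.prod_univ_castSucc]
  simp only [Fin.snoc_castSucc, Fin.snoc_last]
  rw [u.rateAt_snoc τ le_rfl, Finset.prod_congr rfl fun i _ => by
    rw [u.rateAt_snoc τ (hτ i).le]]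
  ring

/-- The last increment would have to leave a level at or beyond failure, where the rate is 0 and
hence so is the intensity. This makes the sum over the number of increments finite. -/
theorem likelihood_eq_zero (lam t : ℝ) {τ : Fin n → ℝ} (hτ : StrictMono τ)
    (hx : x ≤ M.failureLevel) (hn : M.failureLevel < x + n) :
    u.likelihood lam t n τ = 0 := by
  cases n with
  | zero => omega
  | succ n =>
    have hlt : ∀ i, (Fin.init τ : Fin n → ℝ) i < τ (Fin.last n) := fun i =>
      hτ (Fin.castSucc_lt_last i)
    have h0 : u.rateAt ⟨n + 1, τ⟩ (τ (Fin.last n)) = 0 := by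
      conv_lhs => rw [← Fin.snoc_init_self τ]
      rw [Fin.snoc_last, u.rateAt_snoc _ le_rfl, u.rateAt_of_forall_lt hlt]
      exact u.rate_failed _ _ _ (by omega)
    rw [likelihood, Finset.prod_eq_zero (Finset.mem_univ (Fin.last n)), zero_mul]
    rw [h0, M.f_zero, mul_zero]

end Policy

end ProductionSystem

/-! ### The identity between two successive increments -/

theorem lipschitzWith_primitive {g : ℝ → ℝ} {C : NNReal} (hg : Measurable g)
    (hC : ∀ v, |g v| ≤ C) : LipschitzWith C fun w => ∫ v in (0 : ℝ)..w, g v := by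
  refine LipschitzWith.of_dist_le_mul fun p q => ?_
  have hi := intervalIntegrable_of_measurable_of_abs_le hg hC
  rw [Real.dist_eq, intervalIntegral.integral_interval_sub_left (hi 0 p) (hi 0 q), Real.dist_eq]
  exact intervalIntegral.norm_integral_le_of_norm_le_const (f := g) fun v _ => hC v

theorem lipschitzOnWith_exp_neg : LipschitzOnWith 1 (fun x => Real.exp (-x)) (Set.Ici 0) := by
  refine (convex_Ici 0).lipschitzOnWith_of_nnnorm_hasDerivWithin_le
    (f' := fun x => -Real.exp (-x)) (fun x _ => ?_) fun x hx => ?_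
  · simpa using (hasDerivAt_neg x).exp.hasDerivWithinAt
  · rw [← NNReal.coe_le_coe]
    simpa using hx

/-- The change of a discounted value `exp (-∫ φ) * (∫ ρ + W (t - ·))` that is killed at the rate `φ`
and then continued with the value `W'`. -/
theorem discounted_value_add_integral {a t : ℝ} (ha : a ∈ Set.Icc 0 t) {C D : NNReal}
    {ρ φ W Wd W' : ℝ → ℝ} (hρ : Measurable ρ) (hρC : ∀ v, |ρ v| ≤ C)
    (hφ : Measurable φ) (hφ0 : ∀ v, 0 ≤ φ v) (hφD : ∀ v, φ v ≤ D)
    (hW : ∀ v ∈ Set.Icc 0 t, HasDerivWithinAt W (Wd v) (Set.Icc 0 t) v)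
    (hWd : ContinuousOn Wd (Set.Icc 0 t)) (hW' : Continuous W') :
    Real.exp (-∫ v in (0 : ℝ)..t, φ v) * ((∫ v in (0 : ℝ)..t, ρ v) + W 0) +
      (∫ w in a..t, Real.exp (-∫ v in (0 : ℝ)..w, φ v) * φ w *
        ((∫ v in (0 : ℝ)..w, ρ v) + W' (t - w))) =
    Real.exp (-∫ v in (0 : ℝ)..a, φ v) * ((∫ v in (0 : ℝ)..a, ρ v) + W (t - a)) +
      ∫ w in a..t, Real.exp (-∫ v in (0 : ℝ)..w, φ v) *
        (ρ w - φ w * (W (t - w) - W' (t - w)) - Wd (t - w)) := by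
  have hat := ha.2
  have hsub : Set.uIcc a t ⊆ Set.Icc 0 t := by
    rw [Set.uIcc_of_le hat]
    exact Set.Icc_subset_Icc_left ha.1
  have hφabs : ∀ v, |φ v| ≤ D := fun v => (abs_of_nonneg (hφ0 v)).trans_le (hφD v)
  have hΦl := lipschitzWith_primitive hφ hφabs
  have hSl := lipschitzWith_primitive hρ hρC
  set Φ : ℝ → ℝ := fun w => ∫ v in (0 : ℝ)..w, φ v with hΦ
  set S : ℝ → ℝ := fun w => ∫ v in (0 : ℝ)..w, ρ v with hS
  have hE : AbsolutelyContinuousOnInterval (fun w => Real.exp (-Φ w)) a t := by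
    have : LipschitzOnWith (1 * D) ((fun x => Real.exp (-x)) ∘ Φ) (Set.uIcc a t) :=
      lipschitzOnWith_exp_neg.comp hΦl.lipschitzOnWith fun w hw =>
        intervalIntegral.integral_nonneg (hsub hw).1 fun v _ => hφ0 v
    exact this.absolutelyContinuousOnInterval
  obtain ⟨B, hB⟩ := isCompact_Icc.exists_bound_of_continuousOn hWd
  have hrefl : ∀ w ∈ Set.Icc 0 t, t - w ∈ Set.Icc 0 t := fun w hw =>
    ⟨sub_nonneg.2 hw.2, sub_le_self _ hw.1⟩
  have hWl : AbsolutelyContinuousOnInterval (fun w => W (t - w)) a t := by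
    have h1 : LipschitzOnWith (Real.toNNReal B) W (Set.Icc 0 t) :=
      (convex_Icc 0 t).lipschitzOnWith_of_nnnorm_hasDerivWithin_le hW fun v hv =>
        NNReal.le_toNNReal_of_coe_le (hB v hv)
    have h2 : LipschitzWith 1 fun w : ℝ => t - w := by
      simpa using (LipschitzWith.const t).sub LipschitzWith.id
    have : LipschitzOnWith (Real.toNNReal B * 1) (W ∘ fun w => t - w) (Set.uIcc a t) :=
      h1.comp h2.lipschitzOnWith fun w hw => hrefl w (hsub hw)
    exact this.absolutelyContinuousOnInterval
  -- The rates are only measurable in time, so the product rule holds almost everywhere and the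
  -- fundamental theorem is used for absolutely continuous functions.
  have hF : AbsolutelyContinuousOnInterval (fun w => Real.exp (-Φ w) * (S w + W (t - w))) a t :=
    hE.mul (hSl.lipschitzOnWith.absolutelyContinuousOnInterval.add hWl)
  have hφi := intervalIntegrable_of_measurable_of_abs_le hφ hφabs
  have hρi := intervalIntegrable_of_measurable_of_abs_le hρ hρC
  have hderiv : ∀ᵐ w, w ∈ Set.uIoc a t → deriv (fun w => Real.exp (-Φ w) * (S w + W (t - w))) w +
      Real.exp (-Φ w) * φ w * (S w + W' (t - w)) =
      Real.exp (-Φ w) * (ρ w - φ w * (W (t - w) - W' (t - w)) - Wd (t - w)) := by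
    -- At w = t the argument t - w is the endpoint 0, where W has only a one-sided derivative.
    have hne : ∀ᵐ w : ℝ, w ≠ t := by simp [ae_iff, measure_singleton]
    filter_upwards [(hφi 0 t).ae_hasDerivAt_integral, (hρi 0 t).ae_hasDerivAt_integral, hne]
      with w h1 h2 hwt hw
    rw [Set.uIoc_of_le hat] at hw
    have hw0 : 0 < w := ha.1.trans_lt hw.1
    have hwlt : w < t := hw.2.lt_of_ne hwt
    have h0t : (0 : ℝ) ≤ t := ha.1.trans hat
    have hwm : w ∈ Set.uIcc 0 t := by
      rw [Set.uIcc_of_le h0t]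
      exact ⟨hw0.le, hw.2⟩
    have d1 : HasDerivAt Φ (φ w) w := h1 hwm 0 Set.left_mem_uIcc
    have d2 : HasDerivAt S (ρ w) w := h2 hwm 0 Set.left_mem_uIcc
    have d3 : HasDerivAt W (Wd (t - w)) (t - w) :=
      (hW (t - w) (hrefl w ⟨hw0.le, hw.2⟩)).hasDerivAt
        (Icc_mem_nhds (sub_pos.2 hwlt) (sub_lt_self _ hw0))
    have d4 : HasDerivAt (fun w => W (t - w)) (-Wd (t - w)) w := by
      simpa [Function.comp_def] using d3.comp w ((hasDerivAt_id w).const_sub t)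
    have d5 : HasDerivAt (fun w => Real.exp (-Φ w) * (S w + W (t - w))) _ w :=
      d1.fun_neg.exp.fun_mul (d2.fun_add d4)
    rw [d5.deriv]
    ring
  have hcE : Continuous fun w => Real.exp (-Φ w) := Real.continuous_exp.comp hΦl.continuous.neg
  have hGi : IntervalIntegrable (fun w => Real.exp (-Φ w) * φ w * (S w + W' (t - w)))
      volume a t := by
    refine ((hφi a t).continuousOn_mul hcE.continuousOn).mul_continuousOn ?_
    exact (hSl.continuous.add (hW'.comp (continuous_const.sub continuous_id))).continuousOn
  have hsum := hF.integral_deriv_eq_sub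
  rw [← intervalIntegral.integral_congr_ae hderiv,
    intervalIntegral.integral_add hF.intervalIntegrable_deriv hGi, hsum, sub_self]
  ring

namespace ProductionSystem

variable {M : ProductionSystem}

/-- The time derivative of the value function at the level `y`. -/
noncomputable def valueDeriv (M : ProductionSystem) (lam : ℝ) (V : ℕ → ℝ → ℝ) (y : ℕ) (t : ℝ) : ℝ :=
  if y < M.failureLevel then M.hamiltonian lam (V y t - V (y + 1) t) else M.r 0

namespace IsValueFunction

variable {lam T : ℝ} {V : ℕ → ℝ → ℝ}

theorem hasDerivWithinAt (hV : M.IsValueFunction lam T V) (y : ℕ) {t : ℝ} (ht : t ∈ Set.Icc 0 T) :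
    HasDerivWithinAt (V y) (M.valueDeriv lam V y t) (Set.Icc 0 T) t := by
  rw [valueDeriv]
  split_ifs with hy
  · exact hV.hjb y hy t ht
  · have h : HasDerivAt (fun t => M.r 0 * t - M.cost y) (M.r 0) t := by
      simpa using ((hasDerivAt_id t).const_mul (M.r 0)).sub_const (M.cost y)
    exact h.hasDerivWithinAt.congr (hV.failed y (not_lt.1 hy)) (hV.failed y (not_lt.1 hy) t ht)

theorem continuous_valueDeriv (hV : M.IsValueFunction lam T V) (hlam : 0 ≤ lam) (y : ℕ) :
    Continuous (M.valueDeriv lam V y) := by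
  unfold valueDeriv
  split_ifs
  · exact (M.hamiltonian_lipschitz hlam).continuous.comp
      ((hV.continuous y).sub (hV.continuous (y + 1)))
  · exact continuous_const

end IsValueFunction

namespace Policy

variable {x n : ℕ} (u : M.Policy x)

/-- The excess over the optimal value that is gained, per unit of time, by the rates chosen by `u`
after the increments `τ`. -/
noncomputable def drift (lam : ℝ) (V : ℕ → ℝ → ℝ) (t : ℝ) (n : ℕ) (τ : Fin n → ℝ) (w : ℝ) : ℝ :=
  M.r (u.rate n τ w) - lam * M.f (u.rate n τ w) * (V (x + n) (t - w) - V (x + n + 1) (t - w)) -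
    M.valueDeriv lam V (x + n) (t - w)

theorem drift_nonpos (lam : ℝ) (V : ℕ → ℝ → ℝ) (t : ℝ) (τ : Fin n → ℝ) (w : ℝ) :
    u.drift lam V t n τ w ≤ 0 := by
  rw [drift, valueDeriv]
  split_ifs with h
  · exact sub_nonpos.2 (M.le_hamiltonian lam _ (u.rate_mem n τ w))
  · rw [u.rate_failed n τ w (not_lt.1 h), M.f_zero]
    simp

/-- The likelihood of the increments `τ`, times the revenue up to the last of them plus the optimal
value from there on. -/
noncomputable def weightedValue (lam : ℝ) (V : ℕ → ℝ → ℝ) (t : ℝ) (n : ℕ) (τ : Fin n → ℝ) : ℝ :=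
  u.likelihood lam (lastTime τ) n τ * (u.revenue n τ (lastTime τ) + V (x + n) (t - lastTime τ))

variable {lam t : ℝ} {V : ℕ → ℝ → ℝ}

/-- After the increments τ, either none follows before t or the next one comes at some w. The
intensities at τ are a common factor of `discounted_value_add_integral`. -/
theorem likelihood_mul_add_integral (hlam : 0 ≤ lam) (ht : 0 ≤ t)
    (hV : M.IsValueFunction lam t V) {τ : Fin n → ℝ} (hτ : τ ∈ orderedTimes t n) :
    u.likelihood lam t n τ * (u.revenue n τ t - M.cost (x + n)) +
      (∫ w in lastTime τ..t, u.weightedValue lam V t (n + 1) (Fin.snoc τ w)) =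
    u.weightedValue lam V t n τ +
      ∫ w in lastTime τ..t, u.likelihood lam w n τ * u.drift lam V t n τ w := by
  have hC : 0 ≤ max |M.r 0| |M.r M.maxRate| := (abs_nonneg _).trans (le_max_left _ _)
  have hD : 0 ≤ lam * M.f M.maxRate := mul_nonneg hlam (M.f_nonneg M.maxRate_mem_rates)
  have hsec : Measurable fun v : ℝ => (τ, v) := by fun_prop
  have hlast := lastTime_mem ht hτ
  have key := discounted_value_add_integral hlast (C := ⟨_, hC⟩) (D := ⟨_, hD⟩)
    ((u.measurable_r_rateAt n).comp hsec) (u.abs_r_rateAt_le ⟨n, τ⟩)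
    (((u.measurable_f_rateAt n).comp hsec).const_mul lam)
    (u.hazard_nonneg hlam ⟨n, τ⟩) (u.hazard_le hlam ⟨n, τ⟩)
    (fun v hv => hV.hasDerivWithinAt (x + n) hv) (hV.continuous_valueDeriv hlam (x + n)).continuousOn
    (hV.continuous (x + n + 1))
  simp only [Function.comp_def] at key
  have hlt : ∀ w ∈ Set.Ioc (lastTime τ) t, ∀ i, τ i < w := fun w hw i =>
    (le_lastTime hτ.1 i).trans_lt hw.1
  have h1 : ∫ w in lastTime τ..t, u.weightedValue lam V t (n + 1) (Fin.snoc τ w) =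
      (∏ i, lam * M.f (u.rateAt ⟨n, τ⟩ (τ i))) * ∫ w in lastTime τ..t,
        Real.exp (-∫ v in (0 : ℝ)..w, lam * M.f (u.rateAt ⟨n, τ⟩ v)) *
          (lam * M.f (u.rateAt ⟨n, τ⟩ w)) *
          ((∫ v in (0 : ℝ)..w, M.r (u.rateAt ⟨n, τ⟩ v)) + V (x + n + 1) (t - w)) := by
    rw [← intervalIntegral.integral_const_mul]
    refine intervalIntegral.integral_congr_ae (Filter.Eventually.of_forall fun w hw => ?_)
    rw [Set.uIoc_of_le hlast.2] at hw
    have hw0 : 0 ≤ w := hlast.1.trans hw.1.le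
    rw [weightedValue, lastTime_snoc, u.likelihood_snoc lam hw0 (hlt w hw), u.revenue_snoc τ hw0]
    simp only [likelihood, revenue, add_assoc]
    ring
  have h2 : ∫ w in lastTime τ..t, u.likelihood lam w n τ * u.drift lam V t n τ w =
      (∏ i, lam * M.f (u.rateAt ⟨n, τ⟩ (τ i))) * ∫ w in lastTime τ..t,
        Real.exp (-∫ v in (0 : ℝ)..w, lam * M.f (u.rateAt ⟨n, τ⟩ v)) *
          (M.r (u.rateAt ⟨n, τ⟩ w) - lam * M.f (u.rateAt ⟨n, τ⟩ w) *
            (V (x + n) (t - w) - V (x + n + 1) (t - w)) - M.valueDeriv lam V (x + n) (t - w)) := by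
    rw [← intervalIntegral.integral_const_mul]
    refine intervalIntegral.integral_congr_ae (Filter.Eventually.of_forall fun w hw => ?_)
    rw [Set.uIoc_of_le hlast.2] at hw
    rw [likelihood, drift, u.rateAt_of_forall_lt (hlt w hw)]
    ring
  rw [h1, h2, weightedValue]
  simp only [likelihood, revenue]
  rw [hV.initial] at key
  linear_combination (∏ i, lam * M.f (u.rateAt ⟨n, τ⟩ (τ i))) * key

end Policy

end ProductionSystem

/-! ### Verification of the value function -/

namespace ProductionSystem

/-- Fubini for ordered times: the last time is integrated first. -/
theorem setIntegral_orderedTimes_succ {t : ℝ} (ht : 0 ≤ t) {n : ℕ} {g : (Fin (n + 1) → ℝ) → ℝ}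
    (hg : IntegrableOn g (orderedTimes t (n + 1))) :
    IntegrableOn (fun τ => ∫ w in lastTime τ..t, g (Fin.snoc τ w)) (orderedTimes t n) ∧
      ∫ σ in orderedTimes t (n + 1), g σ =
        ∫ τ in orderedTimes t n, ∫ w in lastTime τ..t, g (Fin.snoc τ w) := by
  set e := (MeasurableEquiv.piFinSuccAbove (fun _ : Fin (n + 1) => ℝ) (Fin.last n)).symm with he
  have hpres : MeasurePreserving e := (volume_preserving_piFinSuccAbove
    (fun _ : Fin (n + 1) => ℝ) (Fin.last n)).symm _
  have hsnoc : ∀ w τ, e (w, τ) = Fin.snoc τ w := fun w τ => Fin.insertNth_last' w τ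
  have hind : ∀ τ, ∫ w, (orderedTimes t (n + 1)).indicator g (e (w, τ)) =
      (orderedTimes t n).indicator (fun τ => ∫ w in lastTime τ..t, g (Fin.snoc τ w)) τ := by
    intro τ
    by_cases hτ : τ ∈ orderedTimes t n
    · rw [Set.indicator_of_mem hτ, intervalIntegral.integral_of_le (lastTime_mem ht hτ).2,
        ← integral_indicator measurableSet_Ioc]
      congr 1
      funext w
      by_cases hw : w ∈ Set.Ioc (lastTime τ) t
      · rw [Set.indicator_of_mem hw, hsnoc,
          Set.indicator_of_mem (snoc_mem_orderedTimes_iff.2 ⟨hτ, hw⟩)]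
      · rw [Set.indicator_of_notMem hw, hsnoc,
          Set.indicator_of_notMem fun h => hw (snoc_mem_orderedTimes_iff.1 h).2]
    · rw [Set.indicator_of_notMem hτ]
      refine integral_eq_zero_of_ae (Filter.Eventually.of_forall fun w => ?_)
      simp only [hsnoc, Pi.zero_apply]
      exact Set.indicator_of_notMem (fun h => hτ (snoc_mem_orderedTimes_iff.1 h).1) g
  have hint : Integrable ((orderedTimes t (n + 1)).indicator g ∘ e) :=
    (hpres.integrable_comp_emb e.measurableEmbedding).2
      ((integrable_indicator_iff (measurableSet_orderedTimes t (n + 1))).2 hg)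
  constructor
  · rw [← integrable_indicator_iff (measurableSet_orderedTimes t n)]
    refine (Integrable.integral_prod_right hint).congr (Filter.Eventually.of_forall fun τ => ?_)
    exact hind τ
  · rw [← integral_indicator (measurableSet_orderedTimes t (n + 1)),
      ← integral_indicator (measurableSet_orderedTimes t n),
      ← hpres.integral_comp e.measurableEmbedding]
    refine (integral_prod_symm _ hint).trans (integral_congr_ae
      (Filter.Eventually.of_forall fun τ => ?_))
    exact hind τ

variable {M : ProductionSystem} {x n : ℕ} {lam t : ℝ} {V : ℕ → ℝ → ℝ}

namespace Policy

variable (u : M.Policy x)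

theorem integrableOn_profit (hlam : 0 ≤ lam) (ht : 0 ≤ t) (n : ℕ) :
    IntegrableOn (fun τ => u.likelihood lam t n τ * (u.revenue n τ t - M.cost (x + n)))
      (orderedTimes t n) := by
  have hsec : Measurable fun τ : Fin n → ℝ => (τ, t) := by fun_prop
  have hm : Measurable fun τ => u.likelihood lam t n τ * (u.revenue n τ t - M.cost (x + n)) :=
    ((u.measurable_likelihood lam n).comp hsec).mul
      (((u.measurable_revenue n).comp hsec).sub_const _)
  refine Measure.integrableOn_of_bounded (volume_orderedTimes_lt_top t n).ne
    hm.aestronglyMeasurable (M := (lam * M.f M.maxRate) ^ n *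
      (max |M.r 0| |M.r M.maxRate| * |t| + |M.cost (x + n)|))
    (Filter.Eventually.of_forall fun τ => ?_)
  rw [norm_mul, Real.norm_of_nonneg (u.likelihood_nonneg hlam t τ)]
  refine mul_le_mul (u.likelihood_le hlam ht τ) ?_ (norm_nonneg _)
    ((u.likelihood_nonneg hlam t τ).trans (u.likelihood_le hlam ht τ))
  exact (norm_sub_le _ _).trans (add_le_add (u.abs_revenue_le τ t) le_rfl)

theorem integrableOn_weightedValue (hlam : 0 ≤ lam) (ht : 0 ≤ t)
    (hV : M.IsValueFunction lam t V) (n : ℕ) :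
    IntegrableOn (u.weightedValue lam V t n) (orderedTimes t n) := by
  have hlast := measurable_lastTime n
  have hsec : Measurable fun τ : Fin n → ℝ => (τ, lastTime τ) := measurable_id.prodMk hlast
  have hm : Measurable (u.weightedValue lam V t n) :=
    ((u.measurable_likelihood lam n).comp hsec).mul
      (((u.measurable_revenue n).comp hsec).add
        ((hV.continuous (x + n)).measurable.comp (hlast.const_sub t)))
  obtain ⟨B, hB⟩ := isCompact_Icc.exists_bound_of_continuousOn
    (s := Set.Icc 0 t) (hV.continuous (x + n)).continuousOn
  refine Measure.integrableOn_of_bounded (volume_orderedTimes_lt_top t n).ne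
    hm.aestronglyMeasurable (M := (lam * M.f M.maxRate) ^ n *
      (max |M.r 0| |M.r M.maxRate| * t + B))
    (ae_restrict_of_forall_mem (measurableSet_orderedTimes t n) fun τ hτ => ?_)
  have hl := lastTime_mem ht hτ
  have hC : 0 ≤ max |M.r 0| |M.r M.maxRate| := (abs_nonneg _).trans (le_max_left _ _)
  rw [weightedValue, norm_mul, Real.norm_of_nonneg (u.likelihood_nonneg hlam _ τ)]
  refine mul_le_mul (u.likelihood_le hlam hl.1 τ) ?_ (norm_nonneg _)
    ((u.likelihood_nonneg hlam t τ).trans (u.likelihood_le hlam ht τ))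
  refine (norm_add_le _ _).trans (add_le_add ((u.abs_revenue_le τ _).trans ?_)
    (hB _ ⟨sub_nonneg.2 hl.2, sub_le_self _ hl.1⟩))
  rw [abs_of_nonneg hl.1]
  exact mul_le_mul_of_nonneg_left hl.2 hC

/-- Integrating the one-increment identity over τ turns the next-increment term into the weighted
value for n + 1 increments, so the sum over n telescopes. -/
theorem integral_profit_add (hlam : 0 ≤ lam) (ht : 0 ≤ t)
    (hV : M.IsValueFunction lam t V) (n : ℕ) :
    (∫ τ in orderedTimes t n, u.likelihood lam t n τ * (u.revenue n τ t - M.cost (x + n))) =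
      (∫ τ in orderedTimes t n, u.weightedValue lam V t n τ) -
        (∫ τ in orderedTimes t (n + 1), u.weightedValue lam V t (n + 1) τ) +
      ∫ τ in orderedTimes t n,
        ∫ w in lastTime τ..t, u.likelihood lam w n τ * u.drift lam V t n τ w := by
  obtain ⟨hi, heq⟩ := setIntegral_orderedTimes_succ ht
    (u.integrableOn_weightedValue hlam ht hV (n + 1))
  have hp := u.integrableOn_profit hlam ht n
  have hw := u.integrableOn_weightedValue hlam ht hV n
  have hdrift : ∫ τ in orderedTimes t n,
        ∫ w in lastTime τ..t, u.likelihood lam w n τ * u.drift lam V t n τ w =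
      ∫ τ in orderedTimes t n,
        ((u.likelihood lam t n τ * (u.revenue n τ t - M.cost (x + n)) +
          ∫ w in lastTime τ..t, u.weightedValue lam V t (n + 1) (Fin.snoc τ w)) -
        u.weightedValue lam V t n τ) := by
    refine setIntegral_congr_fun (measurableSet_orderedTimes t n) fun τ hτ => ?_
    rw [u.likelihood_mul_add_integral hlam ht hV hτ, add_sub_cancel_left]
  have hpi : IntegrableOn (fun τ => u.likelihood lam t n τ * (u.revenue n τ t - M.cost (x + n)) +
      ∫ w in lastTime τ..t, u.weightedValue lam V t (n + 1) (Fin.snoc τ w)) (orderedTimes t n) :=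
    hp.add hi
  rw [hdrift, integral_sub hpi hw, integral_add hp hi, heq]
  ring

theorem integral_drift_nonpos (hlam : 0 ≤ lam) (ht : 0 ≤ t) (V : ℕ → ℝ → ℝ) (n : ℕ) :
    (∫ τ in orderedTimes t n,
      ∫ w in lastTime τ..t, u.likelihood lam w n τ * u.drift lam V t n τ w) ≤ 0 := by
  refine setIntegral_nonpos (measurableSet_orderedTimes t n) fun τ hτ => ?_
  rw [intervalIntegral.integral_of_le (lastTime_mem ht hτ).2]
  exact integral_nonpos fun w =>
    mul_nonpos_of_nonneg_of_nonpos (u.likelihood_nonneg hlam w τ) (u.drift_nonpos lam V t τ w)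

/-- The part of the law of the deterioration process with exactly `n` increments. -/
noncomputable def lawOfCount (lam t : ℝ) (n : ℕ) : Measure JumpPath :=
  ((volume.restrict (orderedTimes t n)).withDensity
    fun τ => ENNReal.ofReal (u.likelihood lam t n τ)).map (Sigma.mk n)

theorem measurable_ofReal_likelihood (lam t : ℝ) (n : ℕ) :
    Measurable fun τ : Fin n → ℝ => ENNReal.ofReal (u.likelihood lam t n τ) :=
  ((u.measurable_likelihood lam n).comp measurable_prodMk_right).ennreal_ofReal

theorem integral_lawOfCount (hlam : 0 ≤ lam) {g : JumpPath → ℝ} (hg : Measurable g) :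
    ∫ ω, g ω ∂u.lawOfCount lam t n =
      ∫ τ in orderedTimes t n, u.likelihood lam t n τ * g ⟨n, τ⟩ := by
  rw [lawOfCount, integral_map (JumpPath.measurable_mk n).aemeasurable hg.aestronglyMeasurable,
    integral_withDensity_eq_integral_toReal_smul (u.measurable_ofReal_likelihood lam t n)
      (Filter.Eventually.of_forall fun _ => ENNReal.ofReal_lt_top)]
  simp [ENNReal.toReal_ofReal (u.likelihood_nonneg hlam t _)]

theorem integrable_lawOfCount_iff (hlam : 0 ≤ lam) {g : JumpPath → ℝ} (hg : Measurable g) :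
    Integrable g (u.lawOfCount lam t n) ↔
      IntegrableOn (fun τ => u.likelihood lam t n τ * g ⟨n, τ⟩) (orderedTimes t n) := by
  rw [lawOfCount, integrable_map_measure hg.aestronglyMeasurable
    (JumpPath.measurable_mk n).aemeasurable,
    integrable_withDensity_iff_integrable_smul' (u.measurable_ofReal_likelihood lam t n)
      (Filter.Eventually.of_forall fun _ => ENNReal.ofReal_lt_top)]
  simp [ENNReal.toReal_ofReal (u.likelihood_nonneg hlam t _), IntegrableOn]

theorem expectedProfit_eq_sum (hlam : 0 ≤ lam) (ht : 0 ≤ t) (hx : x ≤ M.failureLevel) :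
    u.expectedProfit lam t = ∑ n ∈ Finset.range (M.failureLevel - x + 1),
      ∫ τ in orderedTimes t n, u.likelihood lam t n τ * (u.revenue n τ t - M.cost (x + n)) := by
  set g : JumpPath → ℝ := fun ω => u.revenue ω.1 ω.2 t - M.cost (x + ω.1) with hgdef
  have hg : Measurable g := JumpPath.measurable_of_comp_mk fun n => by
    have hsec : Measurable fun τ : Fin n → ℝ => (τ, t) := by fun_prop
    exact ((u.measurable_revenue n).comp hsec).sub_const (M.cost (x + n))
  -- Stated for all h because it serves both the profit and its norm, the latter for summability.
  have hzero : ∀ n ∉ Finset.range (M.failureLevel - x + 1), ∀ h : JumpPath → ℝ, Measurable h →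
      ∫ ω, h ω ∂u.lawOfCount lam t n = 0 := by
    intro n hn h hh
    rw [u.integral_lawOfCount hlam hh]
    refine setIntegral_eq_zero_of_forall_eq_zero fun τ hτ => ?_
    rw [Finset.mem_range] at hn
    rw [u.likelihood_eq_zero lam t hτ.1 hx (by omega), zero_mul]
  have hint : Integrable g (Measure.sum (u.lawOfCount lam t)) :=
    integrable_sum_measure
      (fun n => (u.integrable_lawOfCount_iff hlam hg).2 (u.integrableOn_profit hlam ht n))
      (summable_of_ne_finset_zero fun n hn => hzero n hn _ hg.norm)
  calc u.expectedProfit lam t = ∫ ω, g ω ∂Measure.sum (u.lawOfCount lam t) := rfl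
    _ = ∑' n, ∫ ω, g ω ∂u.lawOfCount lam t n := integral_sum_measure hint
    _ = ∑ n ∈ Finset.range (M.failureLevel - x + 1), ∫ ω, g ω ∂u.lawOfCount lam t n :=
      tsum_eq_sum fun n hn => hzero n hn g hg
    _ = _ := Finset.sum_congr rfl fun n _ => u.integral_lawOfCount hlam hg

/-- Verification identity: the expected profit is the solution of the dynamic programming equation
plus the expected drift. -/
theorem expectedProfit_eq_add_drift (hlam : 0 ≤ lam) (ht : 0 ≤ t) (hx : x ≤ M.failureLevel)
    (hV : M.IsValueFunction lam t V) :
    u.expectedProfit lam t = V x t + ∑ n ∈ Finset.range (M.failureLevel - x + 1),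
      ∫ τ in orderedTimes t n,
        ∫ w in lastTime τ..t, u.likelihood lam w n τ * u.drift lam V t n τ w := by
  rw [u.expectedProfit_eq_sum hlam ht hx,
    Finset.sum_congr rfl fun n _ => u.integral_profit_add hlam ht hV n, Finset.sum_add_distrib,
    Finset.sum_range_sub' fun n => ∫ τ in orderedTimes t n, u.weightedValue lam V t n τ]
  have hlast : ∫ τ in orderedTimes t (M.failureLevel - x + 1),
      u.weightedValue lam V t (M.failureLevel - x + 1) τ = 0 := by
    refine setIntegral_eq_zero_of_forall_eq_zero fun τ hτ => ?_
    rw [weightedValue, u.likelihood_eq_zero lam _ hτ.1 hx (by omega), zero_mul]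
  have hfirst : ∫ τ in orderedTimes t 0, u.weightedValue lam V t 0 τ = V x t := by
    have huniv : orderedTimes t 0 = Set.univ :=
      Set.eq_univ_of_forall fun τ => ⟨fun i => i.elim0, fun i => i.elim0⟩
    have hval : ∀ τ, u.weightedValue lam V t 0 τ = V x t := fun τ => by
      simp [weightedValue, likelihood, revenue, lastTime]
    simp only [hval]
    simp [huniv, volume_pi, Measure.real]
  rw [hlast, hfirst, sub_zero]

end Policy

/-- The policy that always produces at the best rate for the value function `V`. -/
noncomputable def greedyPolicy (M : ProductionSystem) (hlam : 0 ≤ lam)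
    (hV : M.IsValueFunction lam t V) (x : ℕ) : M.Policy x where
  rate n _ v := if x + n < M.failureLevel then
    M.bestRate lam (V (x + n) (t - v) - V (x + n + 1) (t - v)) else 0
  measurable_rate n := by
    split_ifs
    · have h : Continuous fun p : (Fin n → ℝ) × ℝ => V (x + n) (t - p.2) - V (x + n + 1) (t - p.2) :=
        ((hV.continuous _).comp (by fun_prop)).sub ((hV.continuous _).comp (by fun_prop))
      exact (M.bestRate_antitone hlam).measurable.comp h.measurable
    · exact measurable_const
  rate_mem n τ v := by
    split_ifs
    · exact M.bestRate_mem lam _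
    · exact M.zero_mem_rates
  rate_failed n τ v h := if_neg h.not_gt

theorem drift_greedyPolicy (hlam : 0 ≤ lam) (hV : M.IsValueFunction lam t V) (x n : ℕ)
    (τ : Fin n → ℝ) (w : ℝ) : (M.greedyPolicy hlam hV x).drift lam V t n τ w = 0 := by
  simp only [Policy.drift, greedyPolicy, valueDeriv]
  split_ifs
  · exact sub_self _
  · simp [M.f_zero]

/-- The drift is nonpositive for every policy and zero for the greedy one, so V is an attained upper
bound. -/
theorem optimalProfit_eq (hlam : 0 ≤ lam) (ht : 0 ≤ t) (hx : x ≤ M.failureLevel)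
    (hV : M.IsValueFunction lam t V) : M.optimalProfit lam x t = V x t := by
  have hle : ∀ u : M.Policy x, u.expectedProfit lam t ≤ V x t := fun u => by
    rw [u.expectedProfit_eq_add_drift hlam ht hx hV]
    exact add_le_of_nonpos_right
      (Finset.sum_nonpos fun n _ => u.integral_drift_nonpos hlam ht V n)
  have heq : (M.greedyPolicy hlam hV x).expectedProfit lam t = V x t := by
    rw [Policy.expectedProfit_eq_add_drift _ hlam ht hx hV]
    simp [drift_greedyPolicy]
  have : Nonempty (M.Policy x) := ⟨M.greedyPolicy hlam hV x⟩
  refine le_antisymm (ciSup_le hle) (heq.ge.trans ?_)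
  exact le_ciSup (f := fun u : M.Policy x => u.expectedProfit lam t)
    ⟨V x t, Set.forall_mem_range.2 hle⟩ _

theorem IsValueFunction.mono {T : ℝ} (hV : M.IsValueFunction lam T V) (htT : t ≤ T) :
    M.IsValueFunction lam t V where
  initial := hV.initial
  hjb y hy s hs := (hV.hjb y hy s (Set.Icc_subset_Icc_right htT hs)).mono
    (Set.Icc_subset_Icc_right htT)
  failed y hy s hs := hV.failed y hy s (Set.Icc_subset_Icc_right htT hs)
  continuous := hV.continuous

end ProductionSystem

theorem proposition2 (M : ProductionSystem) (lam : ℝ) (hlam : 0 ≤ lam)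
    (x : ℕ) (hx : x < M.failureLevel) :
    MonotoneOn (fun t : ℝ => M.marginalValue lam x t) (Set.Ici 0) := by
  intro s hs t ht hst
  -- One solution on the longer horizon t serves both times, since its restriction to [0, v] is a
  -- value function there.
  obtain ⟨V, hV, hmono⟩ := M.exists_isValueFunction hlam (T := t) ht
  have hval : ∀ v ∈ Set.Icc 0 t, M.marginalValue lam x v = V x v - V (x + 1) v := fun v hv => by
    rw [ProductionSystem.marginalValue,
      ProductionSystem.optimalProfit_eq hlam hv.1 hx.le (hV.mono hv.2),
      ProductionSystem.optimalProfit_eq hlam hv.1 hx (hV.mono hv.2)]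
  have hs' : s ∈ Set.Icc 0 t := ⟨hs, hst⟩
  have ht' : t ∈ Set.Icc 0 t := ⟨ht, le_rfl⟩
  simp only [hval s hs', hval t ht']
  exact hmono x hx hs' ht' hst
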